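/- An overpartition of $n$ is a non-increasing sequence of positive integers with sum $n$ in which the first occurrence of each number may be overlined. For positive integers $k, i$, let $\overline{C}_{k,i}(n)$ (Andrews' singular overpartition function) denote the number of overpartitions of $n$ in which no part is divisible by $k$ and only parts congruent to $\pm i \pmod{k}$ may be overlined. Then for every integer $n \ge 1$, $$\overline{C}_{12,3}(n) \equiv \begin{cases} 1 \pmod 2, & \text{if } 3n+1 \text{ is a perfect square},\\ 0 \pmod 2, & \text{otherwise.}\end{cases}$$ That is, $\overline{C}_{12,3}(n)$ is odd if and only if $3n+1$ is a perfect square. -/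

import Mathlib

/-- An overpartition of `n`: a partition of `n` in which the first occurrence of each part size may
be overlined. As the parts are listed in non-increasing order, it is determined by the partition
together with the set of those part sizes whose first occurrence is overlined. -/
@[ext]
structure Overpartition (n : ℕ) extends Nat.Partition n where
  /-- the part sizes whose first occurrence is overlined -/
  overlined : Finset ℕ
  /-- only numbers that occur as parts can be overlined -/
  overlined_subset : ∀ m ∈ overlined, m ∈ parts

/-- An overpartition is a partition together with a subset of its set of part sizes. -/
def Overpartition.equivSigma (n : ℕ) :
    Overpartition n ≃ (p : n.Partition) × {s : Finset ℕ // s ∈ p.parts.toFinset.powerset} where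
  toFun o := ⟨o.toPartition, o.overlined, by
    rw [Finset.mem_powerset]
    exact fun m hm => Multiset.mem_toFinset.2 (o.overlined_subset m hm)⟩
  invFun x := ⟨x.1, x.2.1, fun _ hm =>
    Multiset.mem_toFinset.1 (Finset.mem_powerset.1 x.2.2 hm)⟩
  left_inv _ := rfl
  right_inv _ := rfl

/-- There are only finitely many overpartitions of `n`, so that counting them makes sense. -/
instance Overpartition.instFintype (n : ℕ) : Fintype (Overpartition n) :=
  Fintype.ofEquiv _ (Overpartition.equivSigma n).symm

/-- The condition on an overpartition in the definition of singular overpartitions: no part is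
divisible by `k`, and only parts congruent to `i` or `-i` modulo `k` are overlined. -/
def Overpartition.IsSingular {n : ℕ} (k i : ℕ) (o : Overpartition n) : Prop :=
  (∀ m ∈ o.parts, ¬ k ∣ m) ∧
    ∀ m ∈ o.overlined, (m : ℤ) ≡ (i : ℤ) [ZMOD (k : ℤ)] ∨ (m : ℤ) ≡ -(i : ℤ) [ZMOD (k : ℤ)]

/-- Andrews' singular overpartition function: the number of overpartitions of `n` in which no part
is divisible by `k` and only parts congruent to `i` or `-i` modulo `k` may be overlined. -/
noncomputable def singularOverpartitionCount (k i n : ℕ) : ℕ :=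
  Nat.card {o : Overpartition n // o.IsSingular k i}

/-!
An overpartition counted by `singularOverpartitionCount 12 3 n` is a partition of `n` without parts
divisible by 12, together with an arbitrary subset of its part sizes that are `±3` modulo 12. There
is an odd number of such subsets only if no part is `±3` modulo 12, so modulo 2 one counts the
partitions of `n` into parts `m ≢ 0, ±3 (mod 12)` (`odd_singularOverpartitionCount_iff`).

For a set `A` of positive integers let `E(A) = ∏_{m ∈ A} (1 + X ^ m)` over the field with two
elements (`distinctProd`). There `E(2A) = E(A) ^ 2`, and the generating function of the partitions
into parts from `A` is `1 / E(A)`. If `A` is the disjoint union of `B` and `2A`, then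
`E(A) = E(B) * E(A) ^ 2`, that is `E(A) * E(B) = 1` (`distinctProd_mul_distinctProd_eq_one`). This
applies to `A = {m ≢ 0 (mod 3)}`, `B = {m ≡ ±1 (mod 6)}` and to `A = {m ≡ 0 (mod 6)}`,
`B = {m ≡ 6 (mod 12)}`. As `m ≢ 0, ±3 (mod 12)` means that `m ≢ 0 (mod 3)` or `m ≡ 6 (mod 12)`, the
two identities multiply to `1 / E({m ≢ 0, ±3 (mod 12)}) = E({m ≡ 0, ±1 (mod 6)})`.

Modulo 2, Jacobi's triple product with `a = X` and `b = X ^ 5` turns the right-hand side into the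
sum of `X ^ (k * (3 * k - 2))` over all integers `k`. These exponents are distinct, and `d` is one
of them if and only if `3 * d + 1 = (3 * k - 1) ^ 2` for some `k`, that is, if and only if
`3 * d + 1` is a square.

The triple product is proved in its finite form (`prod_mul_prod_eq_finsum_finiteThetaTerm`) by
induction with the `q`-Pascal rule. For power series without constant term, the `q`-binomial
coefficients become `1` to any given precision after multiplication by `∏ (1 - q ^ j)`
(`X_pow_dvd_prod_sub_sum_thetaTerm`).
-/

open PowerSeries

/-! ### The Jacobi triple product -/

section TripleProduct

variable {R : Type*} [CommRing R]

/-- The term `a ^ (k(k+1)/2) * b ^ (k(k-1)/2)` of index `k : ℤ` of Ramanujan's theta series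
`f(a, b)`. For `k = j ≥ 0` this is `a ^ j * (a * b) ^ (j choose 2)`, and negative indices exchange
`a` and `b`. -/
def thetaTerm (a b : R) : ℤ → R
  | .ofNat k => a ^ k * (a * b) ^ k.choose 2
  | .negSucc k => b ^ (k + 1) * (a * b) ^ (k + 1).choose 2

@[simp] lemma thetaTerm_zero (a b : R) : thetaTerm a b 0 = 1 := by
  change a ^ 0 * (a * b) ^ Nat.choose 0 2 = 1
  simp

lemma thetaTerm_natCast (a b : R) (k : ℕ) :
    thetaTerm a b k = a ^ k * (a * b) ^ k.choose 2 := rfl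

lemma thetaTerm_neg_natCast (a b : R) (k : ℕ) :
    thetaTerm a b (-k) = b ^ k * (a * b) ^ k.choose 2 := by
  cases k with
  | zero => simp
  | succ k => rfl

lemma thetaTerm_neg (a b : R) (k : ℤ) : thetaTerm a b (-k) = thetaTerm b a k := by
  obtain ⟨k, rfl | rfl⟩ := k.eq_nat_or_neg
  · rw [thetaTerm_neg_natCast, thetaTerm_natCast, mul_comm a b]
  · rw [neg_neg, thetaTerm_neg_natCast, thetaTerm_natCast, mul_comm a b]

lemma thetaTerm_succ_mul (a b : R) {m : ℕ} {k : ℤ} (hk : k ≤ m) :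
    thetaTerm a b (k + 1) * (a * b) ^ (m - k).toNat = thetaTerm a b k * (a * (a * b) ^ m) := by
  rcases le_or_gt 0 k with h | h
  · lift k to ℕ using h
    obtain ⟨j, rfl⟩ := Nat.exists_eq_add_of_le (Int.ofNat_le.1 hk)
    have e : ((k + j : ℕ) - (k : ℤ)).toNat = j := by omega
    rw [e, show (k : ℤ) + 1 = (k + 1 : ℕ) by omega, thetaTerm_natCast,
      thetaTerm_natCast, Nat.choose_succ_succ' k 1, Nat.choose_one_right]
    ring
  · obtain ⟨j, rfl⟩ : ∃ j : ℕ, k = -(j + 1 : ℕ) := ⟨(-k - 1).toNat, by omega⟩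
    have e : (m - -((j + 1 : ℕ) : ℤ)).toNat = m + j + 1 := by omega
    have e' : -((j + 1 : ℕ) : ℤ) + 1 = -(j : ℕ) := by omega
    rw [e, e', thetaTerm_neg_natCast, thetaTerm_neg_natCast, Nat.choose_succ_succ' j 1,
      Nat.choose_one_right]
    ring

lemma dvd_thetaTerm {x a b : R} (ha : x ∣ a) (hb : x ∣ b) (k : ℤ) :
    x ^ k.natAbs ∣ thetaTerm a b k := by
  obtain ⟨k, rfl | rfl⟩ := k.eq_nat_or_neg
  · rw [thetaTerm_natCast, Int.natAbs_natCast]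
    exact (pow_dvd_pow_of_dvd ha k).mul_right _
  · rw [thetaTerm_neg_natCast, Int.natAbs_neg, Int.natAbs_natCast]
    exact (pow_dvd_pow_of_dvd hb k).mul_right _

/-- Extension by zero of a sequence to negative indices. -/
def extendZero (u : ℕ → R) (k : ℤ) : R := if 0 ≤ k then u k.toNat else 0

lemma extendZero_natCast (u : ℕ → R) (k : ℕ) : extendZero u k = u k := by simp [extendZero]

lemma extendZero_of_neg (u : ℕ → R) {k : ℤ} (hk : k < 0) : extendZero u k = 0 := by
  simp [extendZero, hk]

/-- If `u n` is the inverse of `(1 - q) ⋯ (1 - q ^ n)`, its recursion holds at every integer, as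
the factor `1 - q ^ 0` vanishes. -/
lemma extendZero_pred {q : R} {u : ℕ → R} (hu : ∀ n, u (n + 1) * (1 - q ^ (n + 1)) = u n)
    (k : ℤ) : extendZero u (k - 1) = extendZero u k * (1 - q ^ k.toNat) := by
  rcases lt_trichotomy k 0 with h | rfl | h
  · rw [extendZero_of_neg u h, extendZero_of_neg u (by omega), zero_mul]
  · rw [extendZero_of_neg u (by omega)]
    simp
  · obtain ⟨j, rfl⟩ : ∃ j : ℕ, k = (j + 1 : ℕ) := ⟨(k - 1).toNat, by omega⟩
    rw [show ((j + 1 : ℕ) : ℤ) - 1 = j by omega, extendZero_natCast, extendZero_natCast,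
      Int.toNat_natCast, hu]

/-- The term of index `k` of the finite triple product, divided by `(1 - q) ⋯ (1 - q ^ (m + n))`,
where `q = a * b` and `u j` stands for the inverse of `(1 - q) ⋯ (1 - q ^ j)`. -/
def finiteThetaTerm (a b : R) (u : ℕ → R) (m n : ℕ) (k : ℤ) : R :=
  extendZero u (m - k) * extendZero u (n + k) * thetaTerm a b k

lemma finiteThetaTerm_swap (a b : R) (u : ℕ → R) (m n : ℕ) (k : ℤ) :
    finiteThetaTerm a b u m n (-k) = finiteThetaTerm b a u n m k := by
  simp only [finiteThetaTerm, thetaTerm_neg, sub_neg_eq_add, ← sub_eq_add_neg]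
  ring

lemma support_finiteThetaTerm_subset (a b : R) (u : ℕ → R) (m n : ℕ) :
    Function.support (finiteThetaTerm a b u m n) ⊆ Finset.Icc (-(n : ℤ)) m := by
  intro k hk
  rw [Function.mem_support, finiteThetaTerm] at hk
  rw [Finset.coe_Icc, Set.mem_Icc]
  by_contra h
  rcases (by omega : (m : ℤ) - k < 0 ∨ (n : ℤ) + k < 0) with h | h <;>
  · rw [extendZero_of_neg u h] at hk
    simp at hk

lemma hasFiniteSupport_finiteThetaTerm (a b : R) (u : ℕ → R) (m n : ℕ) :
    (finiteThetaTerm a b u m n).HasFiniteSupport :=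
  (Finset.finite_toSet _).subset (support_finiteThetaTerm_subset a b u m n)

/-- The `q`-Pascal rule, coming from
`1 - q ^ (x + y) = (1 - q ^ x) + q ^ x * (1 - q ^ y)` with `x = m + 1 - k` and `y = n + k`. -/
lemma finiteThetaTerm_succ_left {a b : R} {u : ℕ → R}
    (hu : ∀ n, u (n + 1) * (1 - (a * b) ^ (n + 1)) = u n) (m n : ℕ) (k : ℤ) :
    finiteThetaTerm a b u m n k + finiteThetaTerm a b u m n (k - 1) * (a * (a * b) ^ m) =
      (1 - (a * b) ^ (m + n + 1)) * finiteThetaTerm a b u (m + 1) n k := by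
  have h1 := extendZero_pred hu (m + 1 - k)
  have h2 := extendZero_pred hu (n + k)
  rw [show (m : ℤ) + 1 - k - 1 = m - k by ring] at h1
  rw [show (n : ℤ) + k - 1 = n + (k - 1) by ring] at h2
  simp only [finiteThetaTerm, Nat.cast_succ]
  rw [show (m : ℤ) - (k - 1) = m + 1 - k by ring, h1, h2]
  by_cases hk : k ≤ m + 1
  · have h3 := thetaTerm_succ_mul a b (m := m) (k := k - 1) (by omega)
    rw [sub_add_cancel, show (m : ℤ) - (k - 1) = m + 1 - k by ring] at h3
    by_cases hk' : 0 ≤ n + k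
    · have h4 : m + n + 1 = ((m : ℤ) + 1 - k).toNat + (n + k).toNat := by omega
      rw [h4, pow_add]
      linear_combination -extendZero u (m + 1 - k) * extendZero u (n + k) *
        (1 - (a * b) ^ ((n : ℤ) + k).toNat) * h3
    · rw [extendZero_of_neg u (by omega : (n : ℤ) + k < 0)]
      ring
  · rw [extendZero_of_neg u (by omega : (m : ℤ) + 1 - k < 0)]
    ring

lemma finsum_finiteThetaTerm_succ_left {a b : R} {u : ℕ → R}
    (hu : ∀ n, u (n + 1) * (1 - (a * b) ^ (n + 1)) = u n) (m n : ℕ) :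
    (∑ᶠ k, finiteThetaTerm a b u m n k) * (1 + a * (a * b) ^ m) =
      (1 - (a * b) ^ (m + n + 1)) * ∑ᶠ k, finiteThetaTerm a b u (m + 1) n k := by
  have hfin := hasFiniteSupport_finiteThetaTerm a b u m n
  have hfin' : (fun k ↦ finiteThetaTerm a b u m n (k - 1)).HasFiniteSupport :=
    Set.Finite.preimage (f := fun k : ℤ ↦ k - 1) (sub_left_injective.injOn) hfin
  rw [mul_finsum' _ _ (hasFiniteSupport_finiteThetaTerm a b u (m + 1) n)]
  simp_rw [← finiteThetaTerm_succ_left hu]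
  rw [finsum_add_distrib hfin (hfin'.subset fun k hk ↦ left_ne_zero_of_mul hk),
    ← finsum_mul' _ _ hfin']
  have hshift := finsum_comp_equiv (Equiv.subRight (1 : ℤ)) (f := finiteThetaTerm a b u m n)
  simp only [Equiv.subRight_apply] at hshift
  rw [hshift]
  ring

lemma finsum_finiteThetaTerm_swap (a b : R) (u : ℕ → R) (m n : ℕ) :
    ∑ᶠ k, finiteThetaTerm a b u m n k = ∑ᶠ k, finiteThetaTerm b a u n m k := by
  simp_rw [← finiteThetaTerm_swap a b]
  exact (finsum_comp_equiv (Equiv.neg ℤ)).symm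

/-- The finite Jacobi triple product. -/
lemma prod_mul_prod_eq_finsum_finiteThetaTerm {a b : R} {u : ℕ → R} (hu0 : u 0 = 1)
    (hu : ∀ n, u (n + 1) * (1 - (a * b) ^ (n + 1)) = u n) (m n : ℕ) :
    (∏ j ∈ Finset.range m, (1 + a * (a * b) ^ j)) *
        ∏ j ∈ Finset.range n, (1 + b * (a * b) ^ j) =
      (∏ j ∈ Finset.range (m + n), (1 - (a * b) ^ (j + 1))) *
        ∑ᶠ k, finiteThetaTerm a b u m n k := by
  induction m with
  | succ m ih =>
    rw [Finset.prod_range_succ, mul_right_comm, ih, mul_assoc,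
      finsum_finiteThetaTerm_succ_left hu, Nat.add_right_comm m 1 n,
      Finset.prod_range_succ, mul_assoc]
  | zero =>
    induction n with
    | zero =>
      rw [finsum_eq_sum_of_support_subset _ (support_finiteThetaTerm_subset a b u 0 0)]
      have h := extendZero_natCast u 0
      simp_all [finiteThetaTerm]
    | succ n ih =>
      have hu' : ∀ n, u (n + 1) * (1 - (b * a) ^ (n + 1)) = u n := by rwa [mul_comm b a]
      have h := finsum_finiteThetaTerm_succ_left hu' n 0
      rw [finsum_finiteThetaTerm_swap, finsum_finiteThetaTerm_swap b a u (n + 1),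
        mul_comm b a] at h
      rw [Finset.prod_range_succ, ← mul_assoc, ih, mul_assoc, h, zero_add, zero_add, add_zero,
        Finset.prod_range_succ, mul_assoc]

end TripleProduct

section PowerSeriesTripleProduct

variable {R : Type*} [CommRing R]

/-- Jacobi's triple product modulo `X ^ (d + 1)`. In the finite triple product, the `q`-binomial
coefficients of the middle terms are inverse to `∏ (1 - q ^ j)` to this precision, and the other
theta terms have large order. -/
theorem X_pow_dvd_prod_sub_sum_thetaTerm {a b : R⟦X⟧} (ha : X ∣ a) (hb : X ∣ b) {d n : ℕ}
    (hn : 2 * d + 1 ≤ n) :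
    X ^ (d + 1) ∣ (∏ j ∈ Finset.range n,
        ((1 + a * (a * b) ^ j) * (1 + b * (a * b) ^ j) * (1 - (a * b) ^ (j + 1)))) -
      ∑ k ∈ Finset.Icc (-(n : ℤ)) n, thetaTerm a b k := by
  have hab : X ∣ a * b := ha.mul_right b
  have hunit (i : ℕ) : ∃ v : R⟦X⟧, (1 - (a * b) ^ (i + 1)) * v = 1 := by
    refine isUnit_iff_exists_inv.1 (isUnit_iff_constantCoeff.2 ?_)
    rw [map_sub, map_pow, X_dvd_iff.1 hab]
    simp
  choose v hv using hunit
  let u : ℕ → R⟦X⟧ := fun n ↦ ∏ i ∈ Finset.range n, v i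
  let P : ℕ → R⟦X⟧ := fun n ↦ ∏ i ∈ Finset.range n, (1 - (a * b) ^ (i + 1))
  have hu (n : ℕ) : u (n + 1) * (1 - (a * b) ^ (n + 1)) = u n := by
    simp only [u]
    rw [Finset.prod_range_succ]
    linear_combination (∏ i ∈ Finset.range n, v i) * hv n
  have hPu (n : ℕ) : P n * u n = 1 := by
    simp only [P, u, ← Finset.prod_mul_distrib, hv, Finset.prod_const_one]
  -- from here on, congruences modulo `X ^ (d + 1)` are equalities in the quotient ring
  let φ := Ideal.Quotient.mk (Ideal.span {(X : R⟦X⟧) ^ (d + 1)})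
  have hφ {x : R⟦X⟧} : φ x = 0 ↔ X ^ (d + 1) ∣ x := by
    rw [Ideal.Quotient.eq_zero_iff_mem, Ideal.mem_span_singleton]
  have hq {i : ℕ} (hi : d + 1 ≤ i) : φ ((a * b) ^ i) = 0 :=
    hφ.2 ((pow_dvd_pow _ hi).trans (pow_dvd_pow_of_dvd hab i))
  have hP (i : ℕ) : φ (P (d + i)) = φ (P d) := by
    induction i with
    | zero => rfl
    | succ i ih =>
      simp only [P] at ih ⊢
      rw [← add_assoc, Finset.prod_range_succ, map_mul, ih, map_sub, hq (by omega)]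
      simp
  have hP' {i : ℕ} (hi : d ≤ i) : φ (P i) = φ (P d) := by
    obtain ⟨j, rfl⟩ := Nat.exists_eq_add_of_le hi
    exact hP j
  have hu' {i : ℕ} (hi : d ≤ i) : φ (P d) * φ (u i) = 1 := by
    rw [← hP' hi, ← map_mul, hPu, map_one]
  rw [← hφ, map_sub, sub_eq_zero, Finset.prod_mul_distrib, Finset.prod_mul_distrib,
    prod_mul_prod_eq_finsum_finiteThetaTerm (by simp [u]) hu,
    finsum_eq_sum_of_support_subset _ (support_finiteThetaTerm_subset a b u n n),
    mul_right_comm, map_mul, map_mul, hP' (by omega : d ≤ n + n), hP' (by omega : d ≤ n),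
    map_sum, map_sum, Finset.mul_sum]
  refine Finset.sum_congr rfl fun k hk ↦ ?_
  rw [Finset.mem_Icc] at hk
  rw [finiteThetaTerm, map_mul]
  by_cases hkd : d + 1 ≤ k.natAbs
  · rw [hφ.2 ((pow_dvd_pow _ hkd).trans (dvd_thetaTerm ha hb k))]
    simp
  · obtain ⟨i, hi⟩ : ∃ i : ℕ, (n : ℤ) - k = i := ⟨(n - k).toNat, by omega⟩
    obtain ⟨j, hj⟩ : ∃ j : ℕ, (n : ℤ) + k = j := ⟨(n + k).toNat, by omega⟩
    rw [hi, hj, extendZero_natCast, extendZero_natCast, map_mul]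
    linear_combination (φ (P d) * φ (u j) * φ (thetaTerm a b k)) * hu' (by omega : d ≤ i) +
      φ (thetaTerm a b k) * hu' (by omega : d ≤ j)

end PowerSeriesTripleProduct

/-! ### Euler products modulo 2 -/

instance : CharP (ZMod 2)⟦X⟧ 2 :=
  charP_of_injective_algebraMap (algebraMap (ZMod 2) (ZMod 2)⟦X⟧).injective 2

section DistinctProd

open Filter Topology
open scoped PowerSeries.WithPiTopology

/-- The generating function modulo 2 of the partitions into distinct parts that satisfy `p`. A
predicate that holds at `0` contributes a factor `1 + X ^ 0 = 0`. -/
noncomputable def distinctProd (p : ℕ → Prop) [DecidablePred p] : (ZMod 2)⟦X⟧ :=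
  ∏' m, if p m then 1 + X ^ m else 1

lemma hasProd_distinctProd (p : ℕ → Prop) [DecidablePred p] :
    HasProd (fun m ↦ if p m then (1 : (ZMod 2)⟦X⟧) + X ^ m else 1) (distinctProd p) := by
  refine Multipliable.hasProd ?_
  have h : (fun m ↦ if p m then (1 : (ZMod 2)⟦X⟧) + X ^ m else 1) =
      fun m ↦ 1 + if p m then X ^ m else 0 := by
    ext1 m
    split_ifs <;> simp
  rw [h]
  refine PowerSeries.WithPiTopology.multipliable_one_add_of_tendsto_order_atTop_nhds_top _ ?_
  refine ENat.tendsto_nhds_top_iff_natCast_lt.mpr fun n ↦ eventually_atTop.mpr ⟨n + 1, ?_⟩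
  intro m hm
  split_ifs
  · rw [order_X_pow]
    exact_mod_cast hm
  · simp

lemma distinctProd_ne_zero {p : ℕ → Prop} [DecidablePred p] (hp : ¬ p 0) :
    distinctProd p ≠ 0 := by
  intro h
  have h1 := (hasProd_distinctProd p).map (constantCoeff (R := ZMod 2))
    (PowerSeries.WithPiTopology.continuous_constantCoeff _)
  have h2 : (constantCoeff (R := ZMod 2)) ∘
      (fun m ↦ if p m then (1 : (ZMod 2)⟦X⟧) + X ^ m else 1) = fun _ ↦ 1 := by
    ext1 m
    by_cases hm : p m
    · have : m ≠ 0 := by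
        rintro rfl
        exact hp hm
      simp [hm, this]
    · simp [hm]
  rw [h2, h, map_zero] at h1
  exact one_ne_zero (hasProd_one.unique h1)

lemma distinctProd_eq_mul {p q r : ℕ → Prop} [DecidablePred p] [DecidablePred q]
    [DecidablePred r] (h : ∀ m, p m ↔ q m ∨ r m) (hdisj : ∀ m, q m → ¬ r m) :
    distinctProd p = distinctProd q * distinctProd r := by
  refine (hasProd_distinctProd p).unique ?_
  convert (hasProd_distinctProd q).mul (hasProd_distinctProd r) using 1
  ext1 m
  have h1 := h m
  have h2 := hdisj m
  by_cases hq : q m <;> by_cases hr : r m <;> simp_all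

/-- The Frobenius map doubles all parts. -/
lemma distinctProd_eq_sq {p q : ℕ → Prop} [DecidablePred p] [DecidablePred q]
    (heven : ∀ m, q (2 * m) ↔ p m) (hodd : ∀ m, ¬ q (2 * m + 1)) :
    distinctProd q = distinctProd p ^ 2 := by
  refine (hasProd_distinctProd q).unique ?_
  rw [← mul_one (distinctProd p ^ 2)]
  refine HasProd.even_mul_odd ?_ ?_
  · convert (hasProd_distinctProd p).pow 2 using 1
    ext1 m
    simp only [heven]
    split_ifs
    · rw [CharTwo.add_sq, one_pow, ← pow_mul, mul_comm]
    · simp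
  · simp only [hodd, if_false]
    exact hasProd_one

/-- If `p` is the disjoint union of `q` and the doubles `r` of `p`, then
`distinctProd p = distinctProd q * distinctProd p ^ 2`. The case where `p` is all positive
numbers and `q` the odd ones is Euler's `∏ (1 + X ^ m) * ∏ (1 - X ^ (2 * m - 1)) = 1`. -/
lemma distinctProd_mul_distinctProd_eq_one {p q r : ℕ → Prop} [DecidablePred p]
    [DecidablePred q] [DecidablePred r] (hp : ¬ p 0) (h : ∀ m, p m ↔ q m ∨ r m)
    (hdisj : ∀ m, q m → ¬ r m) (heven : ∀ m, r (2 * m) ↔ p m) (hodd : ∀ m, ¬ r (2 * m + 1)) :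
    distinctProd p * distinctProd q = 1 := by
  have h1 := distinctProd_eq_mul h hdisj
  rw [distinctProd_eq_sq heven hodd] at h1
  refine mul_left_cancel₀ (distinctProd_ne_zero hp) ?_
  linear_combination -h1

/-- Modulo 2, the geometric series `∑ X ^ (m * j)` is the inverse of `1 + X ^ m`. -/
lemma mk_card_restricted_mul_distinctProd {p : ℕ → Prop} [DecidablePred p] (hp : ¬ p 0) :
    (PowerSeries.mk fun n ↦ ((Nat.Partition.restricted n p).card : ZMod 2)) * distinctProd p =
      1 := by
  have h1 : HasProd (fun i ↦ if p (i + 1) then (1 : (ZMod 2)⟦X⟧) + X ^ (i + 1) else 1)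
      (distinctProd p) := by
    refine ((add_left_injective 1).hasProd_iff ?_).2 (hasProd_distinctProd p)
    intro m hm
    obtain rfl : m = 0 := by
      by_contra h0
      exact hm ⟨m - 1, Nat.succ_pred_eq_of_ne_zero h0⟩
    exact if_neg hp
  refine ((Nat.Partition.hasProd_powerSeriesMk_card_restricted (ZMod 2) p).mul h1).unique ?_
  convert hasProd_one using 2 with i
  split_ifs
  · rw [← CharTwo.sub_eq_add]
    simp_rw [pow_mul]
    exact PowerSeries.WithPiTopology.tsum_pow_mul_one_sub_of_constantCoeff_eq_zero (by simp)
  · simp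

lemma exists_coeff_distinctProd_eq (p : ℕ → Prop) [DecidablePred p] (d N : ℕ) :
    ∃ n ≥ N, ∀ l ≥ n, coeff d (distinctProd p) =
      coeff d (∏ m ∈ Finset.range l, if p m then (1 : (ZMod 2)⟦X⟧) + X ^ m else 1) := by
  have h := (PowerSeries.WithPiTopology.tendsto_iff_coeff_tendsto _ _ _ _).1
    (hasProd_distinctProd p).tendsto_prod_nat d
  rw [nhds_discrete, tendsto_pure, eventually_atTop] at h
  obtain ⟨n, hn⟩ := h
  exact ⟨max n N, le_max_right _ _, fun l hl ↦ (hn l ((le_max_left _ _).trans hl)).symm⟩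

end DistinctProd

/-! ### Parts congruent to `0` or `±1` modulo `6` -/

/-- The exponent of the theta term of index `k ≥ 0` for `a = X` and `b = X ^ 5`. -/
lemma add_six_mul_choose_two (k : ℕ) : (k + 6 * k.choose 2 : ℤ) = k * (3 * k - 2) := by
  induction k with
  | zero => simp
  | succ k ih =>
    rw [Nat.choose_succ_succ' k 1, Nat.choose_one_right]
    push_cast
    linear_combination ih

lemma thetaTerm_X_X_pow_five {R : Type*} [CommRing R] (k : ℤ) :
    thetaTerm (X : R⟦X⟧) (X ^ 5) k = X ^ (k * (3 * k - 2)).toNat := by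
  obtain ⟨k, rfl | rfl⟩ := k.eq_nat_or_neg
  · have h := add_six_mul_choose_two k
    have e : ((k : ℤ) * (3 * k - 2)).toNat = k + 6 * k.choose 2 := by omega
    rw [thetaTerm_natCast, e]
    ring
  · have h := add_six_mul_choose_two k
    have e : (-(k : ℤ) * (3 * -k - 2)).toNat = 5 * k + 6 * k.choose 2 := by
      have : -(k : ℤ) * (3 * -k - 2) = k * (3 * k - 2) + 4 * k := by ring
      omega
    rw [thetaTerm_neg_natCast, e]
    ring

lemma abs_le_mul_three_mul_sub_two (k : ℤ) : |k| ≤ k * (3 * k - 2) := by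
  rcases le_or_gt k 0 with h | h
  · rw [abs_of_nonpos h]
    nlinarith
  · rw [abs_of_pos h]
    nlinarith

lemma isSquare_three_mul_add_one_iff (d : ℕ) :
    IsSquare (3 * d + 1) ↔ ∃ k : ℤ, k * (3 * k - 2) = d := by
  constructor
  · rintro ⟨r, hr⟩
    have hr' : (3 * d + 1 : ℤ) = r * r := by exact_mod_cast hr
    obtain ⟨t, ht⟩ : ∃ t : ℤ, r = 3 * t ∨ r = 3 * t + 1 ∨ r = 3 * t + 2 := ⟨r / 3, by omega⟩
    rcases ht with ht | ht | ht <;> rw [ht] at hr'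
    · have : (3 : ℤ) * (3 * t * t - d) = 1 := by linear_combination -hr'
      omega
    -- the root is `r = ±(3 * k - 1)`
    · exact ⟨-t, by linarith⟩
    · exact ⟨t + 1, by linarith⟩
  · rintro ⟨k, hk⟩
    refine ⟨(3 * k - 1).natAbs, ?_⟩
    zify
    rw [abs_mul_abs_self]
    linear_combination -3 * hk

lemma prod_range_six_mul_add_one (n : ℕ) :
    ∏ m ∈ Finset.range (6 * n + 1),
        (if m ≠ 0 ∧ (m % 6 = 0 ∨ m % 6 = 1 ∨ m % 6 = 5) then (1 : (ZMod 2)⟦X⟧) + X ^ m else 1) =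
      ∏ j ∈ Finset.range n, ((1 + X * (X * X ^ 5) ^ j) * (1 + X ^ 5 * (X * X ^ 5) ^ j) *
        (1 - (X * X ^ 5) ^ (j + 1))) := by
  induction n with
  | zero => simp
  | succ n ih =>
    rw [show 6 * (n + 1) + 1 = 6 * n + 1 + 1 + 1 + 1 + 1 + 1 + 1 by ring]
    rw [Finset.prod_range_succ, Finset.prod_range_succ, Finset.prod_range_succ,
      Finset.prod_range_succ, Finset.prod_range_succ, Finset.prod_range_succ, ih,
      Finset.prod_range_succ, if_pos (by omega), if_neg (by omega), if_neg (by omega),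
      if_neg (by omega), if_pos (by omega), if_pos (by omega), CharTwo.sub_eq_add]
    ring

/-- By the triple product, the series is `∑ X ^ (k * (3 * k - 2))` over `k : ℤ`, in which the
exponents are distinct. -/
lemma coeff_distinctProd_zero_one_five_mod_six (d : ℕ) :
    coeff d (distinctProd fun m ↦ m ≠ 0 ∧ (m % 6 = 0 ∨ m % 6 = 1 ∨ m % 6 = 5)) ≠ 0 ↔
      IsSquare (3 * d + 1) := by
  obtain ⟨n, hn, hcoeff⟩ := exists_coeff_distinctProd_eq
    (fun m ↦ m ≠ 0 ∧ (m % 6 = 0 ∨ m % 6 = 1 ∨ m % 6 = 5)) d (2 * d + 1)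
  have hdvd := X_pow_dvd_prod_sub_sum_thetaTerm (R := ZMod 2) (a := X) (b := X ^ 5) dvd_rfl
    (dvd_pow_self X (by norm_num)) hn
  have hd := X_pow_dvd_iff.1 hdvd d d.lt_succ_self
  rw [map_sub, sub_eq_zero] at hd
  rw [hcoeff (6 * n + 1) (by omega), prod_range_six_mul_add_one, hd, map_sum,
    isSquare_three_mul_add_one_iff]
  have hterm (k : ℤ) : coeff d (thetaTerm (X : (ZMod 2)⟦X⟧) (X ^ 5) k) =
      if k * (3 * k - 2) = d then 1 else 0 := by
    have := (abs_nonneg k).trans (abs_le_mul_three_mul_sub_two k)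
    rw [thetaTerm_X_X_pow_five, coeff_X_pow]
    exact if_congr (by omega) rfl rfl
  simp_rw [hterm]
  constructor
  · intro h
    obtain ⟨k, -, hk⟩ := Finset.exists_ne_zero_of_sum_ne_zero h
    exact ⟨k, of_not_not fun h' ↦ hk (if_neg h')⟩
  · rintro ⟨k, hk⟩
    rw [Finset.sum_eq_single k, if_pos hk]
    · exact one_ne_zero
    · intro l _ hl
      refine if_neg fun hl' ↦ ?_
      have : (l - k) * (3 * (l + k) - 2) = 0 := by linear_combination hl' - hk
      rcases mul_eq_zero.1 this with h | h <;> omega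
    · intro h
      have h1 := abs_le_mul_three_mul_sub_two k
      rw [hk, abs_le] at h1
      rw [Finset.mem_Icc] at h
      omega

/-! ### Singular overpartitions modulo 2 -/

/-- A singular overpartition is a partition without parts divisible by `k`, together with a set of
part sizes that are congruent to `±i` modulo `k`. -/
def Overpartition.singularEquivSigma (k i n : ℕ) :
    {o : Overpartition n // o.IsSingular k i} ≃
      (p : {p : n.Partition // ∀ m ∈ p.parts, ¬ k ∣ m}) ×
        {s : Finset ℕ // s ∈ (p.1.parts.toFinset.filter fun m : ℕ ↦
          (m : ℤ) ≡ i [ZMOD k] ∨ (m : ℤ) ≡ -i [ZMOD k]).powerset} where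
  toFun o := ⟨⟨o.1.toPartition, o.2.1⟩, o.1.overlined, by
    rw [Finset.mem_powerset]
    exact fun m hm ↦ Finset.mem_filter.2
      ⟨Multiset.mem_toFinset.2 (o.1.overlined_subset m hm), o.2.2 m hm⟩⟩
  invFun x := ⟨⟨x.1.1, x.2.1, fun _ hm ↦ Multiset.mem_toFinset.1
    (Finset.mem_filter.1 (Finset.mem_powerset.1 x.2.2 hm)).1⟩, x.1.2, fun _ hm ↦
      (Finset.mem_filter.1 (Finset.mem_powerset.1 x.2.2 hm)).2⟩
  left_inv _ := rfl
  right_inv _ := rfl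

/-- A partition gives rise to `2 ^ s` singular overpartitions, where `s` is its number of part
sizes that may be overlined, so that only the partitions with `s = 0` matter modulo 2. -/
lemma odd_singularOverpartitionCount_iff (k i n : ℕ) :
    Odd (singularOverpartitionCount k i n) ↔ Odd (Nat.Partition.restricted n fun m : ℕ ↦
      ¬ k ∣ m ∧ ¬ ((m : ℤ) ≡ i [ZMOD k] ∨ (m : ℤ) ≡ -i [ZMOD k])).card := by
  rw [singularOverpartitionCount, Nat.card_congr (Overpartition.singularEquivSigma k i n),
    Nat.card_sigma, Finset.odd_sum_iff_odd_card_odd]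
  simp only [Nat.card_eq_fintype_card, Fintype.card_coe, Finset.card_powerset]
  have hodd (s : ℕ) : Odd (2 ^ s) ↔ s = 0 := by
    cases s <;> simp [pow_succ]
  simp only [hodd, Finset.card_eq_zero, Finset.filter_eq_empty_iff, Multiset.mem_toFinset]
  rw [← Finset.card_map (Function.Embedding.subtype _)]
  refine iff_of_eq (congrArg (fun s : Finset n.Partition ↦ Odd s.card) ?_)
  ext p
  simp only [Nat.Partition.restricted, Finset.mem_map, Finset.mem_filter, Finset.mem_univ,
    true_and, Function.Embedding.coe_subtype, Subtype.exists, exists_and_right, exists_eq_right,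
    forall_and, exists_prop]

theorem mainTheorem5 (n : ℕ) (hn : 1 ≤ n) :
    Odd (singularOverpartitionCount 12 3 n) ↔ IsSquare (3 * n + 1) := by
  have hpred (m : ℕ) : (¬ 12 ∣ m ∧ ¬ ((m : ℤ) ≡ (3 : ℕ) [ZMOD (12 : ℕ)] ∨
      (m : ℤ) ≡ -(3 : ℕ) [ZMOD (12 : ℕ)])) ↔ m % 3 ≠ 0 ∨ m % 12 = 6 := by
    simp only [Int.ModEq]
    omega
  rw [odd_singularOverpartitionCount_iff]
  simp only [hpred]
  -- With `A`, `B`, `C`, `D`, `E`, `F` the products over `m ≢ 0, ±3 (mod 12)`, `m ≢ 0 (mod 3)`,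
  -- `m ≡ 6 (mod 12)`, `m ≡ 0, ±1 (mod 6)`, `m ≡ ±1 (mod 6)` and `m ≡ 0 (mod 6)`: `A = B * C`,
  -- `D = E * F`, `B * E = 1` and `F * C = 1`, hence `A * D = 1`.
  have hA := distinctProd_eq_mul (p := fun m ↦ m % 3 ≠ 0 ∨ m % 12 = 6) (q := fun m ↦ m % 3 ≠ 0)
    (r := fun m ↦ m % 12 = 6) (fun _ ↦ Iff.rfl) (by omega)
  have hD := distinctProd_eq_mul
    (p := fun m ↦ m ≠ 0 ∧ (m % 6 = 0 ∨ m % 6 = 1 ∨ m % 6 = 5))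
    (q := fun m ↦ m % 6 = 1 ∨ m % 6 = 5) (r := fun m ↦ m ≠ 0 ∧ m % 6 = 0) (by omega) (by omega)
  have hBE := distinctProd_mul_distinctProd_eq_one (p := fun m ↦ m % 3 ≠ 0)
    (q := fun m ↦ m % 6 = 1 ∨ m % 6 = 5) (r := fun m ↦ m % 6 = 2 ∨ m % 6 = 4)
    (by omega) (by omega) (by omega) (by omega) (by omega)
  have hCF := distinctProd_mul_distinctProd_eq_one (p := fun m ↦ m ≠ 0 ∧ m % 6 = 0)
    (q := fun m ↦ m % 12 = 6) (r := fun m ↦ m ≠ 0 ∧ m % 12 = 0)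
    (by omega) (by omega) (by omega) (by omega) (by omega)
  have hgen := mk_card_restricted_mul_distinctProd (p := fun m ↦ m % 3 ≠ 0 ∨ m % 12 = 6)
    (by omega)
  have hmk : (PowerSeries.mk fun n ↦ ((Nat.Partition.restricted n
      fun m ↦ m % 3 ≠ 0 ∨ m % 12 = 6).card : ZMod 2)) =
      distinctProd fun m ↦ m ≠ 0 ∧ (m % 6 = 0 ∨ m % 6 = 1 ∨ m % 6 = 5) := by
    refine left_inv_eq_right_inv hgen ?_
    rw [hA, hD, mul_mul_mul_comm, hBE, one_mul, mul_comm, hCF]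
  rw [← coeff_distinctProd_zero_one_five_mod_six, ← hmk, coeff_mk, ZMod.natCast_ne_zero_iff_odd]
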